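/- Let $d\in\{2,3\}$. Let $\Omega\subset\mathbb R^d$ be a bounded domain (open, connected) and let $\Omega^+,\Omega^-\subset\Omega$ be disjoint, nonempty, open, connected sets (subdomains). Put $\Gamma=\Omega\setminus(\Omega^+\cup\Omega^-)$ and assume that $\Gamma\subset\partial\Omega^+\cap\partial\Omega^-$ and that $\Gamma$ has finite $(d-1)$-dimensional (Hausdorff) surface measure. Let the crack $\Gamma_T\subset\Gamma$ be a Borel set with $\overline{\Gamma_T}\subset\Omega$, such that for surface-almost every point of $\Gamma_T$ the outward unit normals $n^\pm$ of $\Omega^\pm$ exist (in the measure-theoretic sense; for Lipschitz domains these are the usual ones), and put $\Gamma_0=\Gamma\setminus\Gamma_T$. Assume that $\partial\Omega\cap\partial\Omega^+$ and $\partial\Omega\cap\partial\Omega^-$ have positive surface measure. Let $\mu_L,\lambda_L\in\mathbb R$ satisfy $\mu_L>0$ and $2\mu_L+d\lambda_L>0$, let $f\in L^2(\Omega)^d$ and $p\in\mathbb R$, and set $\varepsilon(u)=\frac12(\nabla u+\nabla u^T)$, $\sigma_L(u)=2\mu_L\varepsilon(u)+\lambda_L(\operatorname{div}u)I$. Let $\mathcal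 T_h$ be a finite mesh of $\overline\Omega$ by convex polytopes (for instance simplices) with nonempty, pairwise disjoint interiors, whose union is $\overline\Omega$; for each $T\in\mathcal T_h$ let $P(T)$ be a finite-dimensional space of $\mathbb R^d$-valued functions of class $C^1$ on $T$. Let $$\tilde V_h=\{v\in C(\overline\Omega)^d : v=0\text{ on }\partial\Omega,\ v|_T\in P(T)\ \ \forall T\in\mathcal T_h\},\qquad V_h^\pm=\tilde V_h|_{\Omega^\pm}.$$ Let $\tilde W_h$ be a finite-dimensional space of $\mathbb R^d$-valued functions that are square integrable on $\Omega$ and whose restrictions to $\Gamma_0$ are square integrable for the surface measure, and let $W_h=\tilde W_h|_{\Gamma_0}\subset L^2(\Gamma_0)^d$. Define $$a_0^\pm(u,v)=\int_{\Omega^\pm}\sigma_L(u):\varepsilon(v)\,dx,\qquad b_0(\mu,v)=\int_{\Gamma_0}\mu\cdot v\,d\Gamma_0,\qquad l^\pm(v)=\int_{\Omega^\pm}f\cdot v\,dx+\int_{\Gamma_T}v\cdot p\,n^\pm\,d\Gamma_T,$$ where the values on $\Gamma$ of a function of $V_h^\pm$ are those of its continuous extension from $\Omega^\pm$. Assume hypothesis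 (H): if $\mu_h\in W_h$ satisfies $b_0(\mu_h,v)=0$ for all $v\in V_h^+$ and for all $v\in V_h^-$, then $\mu_h=0$. Then there is exactly one triple $(u_h^+,u_h^-,\lambda_h)\in V_h^+\times V_h^-\times W_h$ such that $$\begin{aligned}a_0^+(u_h^+,v)+b_0(\lambda_h,v)&=l^+(v)&&\forall v\in V_h^+,\\ a_0^-(u_h^-,v)-b_0(\lambda_h,v)&=l^-(v)&&\forall v\in V_h^-,\\ b_0(\mu,u_h^+)-b_0(\mu,u_h^-)&=0&&\forall\mu\in W_h.\end{aligned}$$ -/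

import Mathlib

open MeasureTheory Set Filter Topology

namespace CrackFEM

noncomputable section

/-- The Euclidean space `ℝ^d`. -/
abbrev Vec (d : ℕ) : Type := EuclideanSpace ℝ (Fin d)

/-- Surface measure on hypersurfaces of `ℝ^d`: the `(d-1)`-dimensional Hausdorff measure, with the
Euclidean normalization. -/
def surf (d : ℕ) : Measure (Vec d) := Measure.euclideanHausdorffMeasure (d - 1)

/-- `n` is the (measure theoretic) outward unit normal of `U` at `x`: blown up around `x`, the set
`U` becomes the half space `{y | ⟪y - x, n⟫ < 0}`. At almost every boundary point of a Lipschitz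
domain this is the usual outward unit normal. -/
def IsOutwardUnitNormal {d : ℕ} (U : Set (Vec d)) (x n : Vec d) : Prop :=
  ‖n‖ = 1 ∧
  Tendsto (fun r : ℝ => volume.real ((Metric.ball x r ∩ U) ∩ {y | 0 ≤ inner ℝ (y - x) n}) / r ^ d)
    (𝓝[>] 0) (𝓝 0) ∧
  Tendsto (fun r : ℝ => volume.real ((Metric.ball x r \ U) ∩ {y | inner ℝ (y - x) n ≤ 0}) / r ^ d)
    (𝓝[>] 0) (𝓝 0)

open Classical in
/-- The outward unit normal of `U` at `x` (and `0` at the points where there is none). -/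
def outwardNormal {d : ℕ} (U : Set (Vec d)) (x : Vec d) : Vec d :=
  if h : ∃ n, IsOutwardUnitNormal U x n then h.choose else 0

/-- A bounded domain `Ω` of `ℝ^d` with a crack `ΓT`, which an extension of the crack splits into two
subdomains `Ωp` and `Ωm` (for `Ω⁺` and `Ω⁻`). -/
structure CrackedDomain (d : ℕ) where
  Ω : Set (Vec d)
  Ωp : Set (Vec d)
  Ωm : Set (Vec d)
  ΓT : Set (Vec d)
  isOpen_Ω : IsOpen Ω
  isConnected_Ω : IsConnected Ω
  isBounded_Ω : Bornology.IsBounded Ω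
  isOpen_Ωp : IsOpen Ωp
  isConnected_Ωp : IsConnected Ωp
  isOpen_Ωm : IsOpen Ωm
  isConnected_Ωm : IsConnected Ωm
  Ωp_subset : Ωp ⊆ Ω
  Ωm_subset : Ωm ⊆ Ω
  disjoint_Ωp_Ωm : Disjoint Ωp Ωm
  /-- The interface `Γ = Ω \ (Ω⁺ ∪ Ω⁻)` is part of the boundary of `Ω⁺` and of `Ω⁻`. -/
  interface_subset : Ω \ (Ωp ∪ Ωm) ⊆ frontier Ωp ∩ frontier Ωm
  /-- The interface has finite length (`d = 2`) or area (`d = 3`). -/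
  interface_finite : surf d (Ω \ (Ωp ∪ Ωm)) < ⊤
  /-- The crack is part of the interface. -/
  ΓT_subset : ΓT ⊆ Ω \ (Ωp ∪ Ωm)
  /-- The crack does not reach the boundary of `Ω`. -/
  closure_ΓT_subset : closure ΓT ⊆ Ω
  measurableSet_ΓT : MeasurableSet ΓT
  /-- The outward unit normals `n⁺` and `n⁻` exist almost everywhere on the crack. -/
  exists_normal : ∀ᵐ x ∂((surf d).restrict ΓT),
    (∃ n, IsOutwardUnitNormal Ωp x n) ∧ (∃ n, IsOutwardUnitNormal Ωm x n)
  /-- Both subdomains are clamped along a part of `∂Ω` of positive surface measure. -/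
  clamped_p : 0 < surf d (frontier Ω ∩ frontier Ωp)
  clamped_m : 0 < surf d (frontier Ω ∩ frontier Ωm)

namespace CrackedDomain

variable {d : ℕ} (G : CrackedDomain d)

/-- The interface `Γ`, with `Ω = Ω⁺ ∪ Γ ∪ Ω⁻`. -/
def Γ : Set (Vec d) := G.Ω \ (G.Ωp ∪ G.Ωm)

/-- The artificial extension `Γ₀ = Γ \ Γ_T` of the crack. -/
def Γ0 : Set (Vec d) := G.Γ \ G.ΓT

/-- The surface measure of `Γ₀`. -/
def surfΓ0 : Measure (Vec d) := (surf d).restrict G.Γ0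

end CrackedDomain

/-- A finite mesh of `Ω` by convex polytopes (simplices, Cartesian cells, ...), together with a
finite dimensional space `P T` of functions that are `C¹` up to the boundary of `T`, for each
cell `T`. -/
structure FiniteElements {d : ℕ} (Ω : Set (Vec d)) where
  cells : Finset (Set (Vec d))
  polytope : ∀ T ∈ cells, ∃ s : Finset (Vec d), T = convexHull ℝ (s : Set (Vec d))
  nonempty_interior : ∀ T ∈ cells, (interior T).Nonempty
  disjoint_interior : ∀ T ∈ cells, ∀ T' ∈ cells, T ≠ T' → Disjoint (interior T) (interior T')
  cover : (⋃ T ∈ cells, T) = closure Ω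
  P : Set (Vec d) → Submodule ℝ (Vec d → Vec d)
  finiteDimensional_P : ∀ T ∈ cells, FiniteDimensional ℝ (P T)
  contDiffOn_P : ∀ T ∈ cells, ∀ q ∈ P T, ContDiffOn ℝ 1 q T

/-- The space `Ṽ_h` of the continuous functions on the closure of `Ω` which vanish on `∂Ω` and whose
restriction to each cell `T` belongs to `P T`. -/
def FiniteElements.Vtilde {d : ℕ} {Ω : Set (Vec d)} (F : FiniteElements Ω) :
    Submodule ℝ C(closure Ω, Vec d) where
  carrier := {v | (∀ x : closure Ω, (x : Vec d) ∈ frontier Ω → v x = 0) ∧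
    ∀ T ∈ F.cells, ∃ q ∈ F.P T, ∀ x : closure Ω, (x : Vec d) ∈ T → v x = q x}
  zero_mem' := ⟨fun _ _ => rfl, fun T _ => ⟨0, (F.P T).zero_mem, fun _ _ => rfl⟩⟩
  add_mem' := by
    rintro v w ⟨hv, hv'⟩ ⟨hw, hw'⟩
    refine ⟨fun x hx => by simp [hv x hx, hw x hx], fun T hT => ?_⟩
    obtain ⟨q, hq, hvq⟩ := hv' T hT
    obtain ⟨r, hr, hwr⟩ := hw' T hT
    exact ⟨q + r, (F.P T).add_mem hq hr, fun x hx => by simp [hvq x hx, hwr x hx]⟩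
  smul_mem' := by
    rintro c v ⟨hv, hv'⟩
    refine ⟨fun x hx => by simp [hv x hx], fun T hT => ?_⟩
    obtain ⟨q, hq, hvq⟩ := hv' T hT
    exact ⟨c • q, (F.P T).smul_mem c hq, fun x hx => by simp [hvq x hx]⟩

/-- Restriction to `U` of the functions on `closure Ω`, for `U ⊆ Ω`. -/
def restrictTo {d : ℕ} {Ω U : Set (Vec d)} (hU : U ⊆ Ω) :
    C(closure Ω, Vec d) →ₗ[ℝ] (U → Vec d) where
  toFun v := fun x => v ⟨x, subset_closure (hU x.2)⟩
  map_add' _ _ := rfl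
  map_smul' _ _ := rfl

/-- The space `V_h⁺`: restrictions of the elements of `Ṽ_h` to `Ω⁺`. -/
def Vp {d : ℕ} (G : CrackedDomain d) (F : FiniteElements G.Ω) : Submodule ℝ (G.Ωp → Vec d) :=
  F.Vtilde.map (restrictTo G.Ωp_subset)

/-- The space `V_h⁻`: restrictions of the elements of `Ṽ_h` to `Ω⁻`. -/
def Vm {d : ℕ} (G : CrackedDomain d) (F : FiniteElements G.Ω) : Submodule ℝ (G.Ωm → Vec d) :=
  F.Vtilde.map (restrictTo G.Ωm_subset)

/-- A finite dimensional space `W̃_h` of functions that are square integrable on `Ω`, and whose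
restrictions to `Γ₀` are square integrable for the surface measure. -/
structure MultiplierSpace {d : ℕ} (G : CrackedDomain d) where
  Wtilde : Submodule ℝ (Vec d → Vec d)
  finiteDimensional_Wtilde : FiniteDimensional ℝ Wtilde
  memLp_Ω : ∀ w ∈ Wtilde, MemLp w 2 (volume.restrict G.Ω)
  memLp_Γ0 : ∀ w ∈ Wtilde, MemLp w 2 G.surfΓ0

/-- The space `W_h` of the restrictions to `Γ₀` of the elements of `W̃_h`, a subspace
of `L²(Γ₀)`. -/
def MultiplierSpace.Wh {d : ℕ} {G : CrackedDomain d} (M : MultiplierSpace G) :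
    Submodule ℝ (Lp (Vec d) 2 G.surfΓ0) where
  carrier := {g | ∃ w ∈ M.Wtilde, g =ᵐ[G.surfΓ0] w}
  zero_mem' := ⟨0, M.Wtilde.zero_mem, Lp.coeFn_zero _ _ _⟩
  add_mem' := by
    rintro g g' ⟨w, hw, h⟩ ⟨w', hw', h'⟩
    exact ⟨w + w', M.Wtilde.add_mem hw hw', (Lp.coeFn_add g g').trans (h.add h')⟩
  smul_mem' := by
    rintro c g ⟨w, hw, h⟩
    exact ⟨c • w, M.Wtilde.smul_mem c hw, (Lp.coeFn_smul c g).trans (h.const_smul c)⟩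

section Forms

variable {d : ℕ} {U : Set (Vec d)}

/-- Extension by zero of a function on `U`. -/
def zeroExt (u : U → Vec d) : Vec d → Vec d := Function.extend Subtype.val u 0

/-- The trace at the points of `∂U` of a function on `U`: its extension by continuity. -/
def trace (u : U → Vec d) : Vec d → Vec d := extendFrom U (zeroExt u)

/-- The gradient `(∂_j u_i)_{ij}` at a point of the open set `U`. A function of `Ṽ_h` is
differentiable off the boundaries of the cells, hence almost everywhere, and, being continuous and
piecewise `C¹`, it has this function as weak gradient. -/
def grad (u : U → Vec d) (x : Vec d) : Matrix (Fin d) (Fin d) ℝ :=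
  Matrix.of fun i j => fderiv ℝ (zeroExt u) x (EuclideanSpace.single j 1) i

/-- The linearized strain `ε(u) = (∇u + ∇uᵀ)/2`. -/
def strain (u : U → Vec d) (x : Vec d) : Matrix (Fin d) (Fin d) ℝ :=
  (1 / 2 : ℝ) • (grad u x + (grad u x).transpose)

/-- The Lamé stress `σ_L(u) = 2 μ_L ε(u) + λ_L (div u) I`. -/
def stress (lam mu : ℝ) (u : U → Vec d) (x : Vec d) : Matrix (Fin d) (Fin d) ℝ :=
  (2 * mu) • strain u x + (lam * (grad u x).trace) • (1 : Matrix (Fin d) (Fin d) ℝ)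

/-- The bilinear form `a₀(u, v) = ∫_U σ_L(u) : ε(v)`. -/
def a0 (lam mu : ℝ) (u v : U → Vec d) : ℝ :=
  ∫ x in U, (stress lam mu u x * (strain v x).transpose).trace

/-- The bilinear form `b₀(μ, v) = ∫_{Γ₀} μ · v`. -/
def b0 (G : CrackedDomain d) (m : Lp (Vec d) 2 G.surfΓ0) (v : U → Vec d) : ℝ :=
  ∫ x, inner ℝ (m x) (trace v x) ∂G.surfΓ0

/-- The linear form `l(v) = ∫_U f · v + ∫_{Γ_T} v · p n`, with `n` the outward unit normal
of `U`. -/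
def load (G : CrackedDomain d) (f : Vec d → Vec d) (p : ℝ) (v : U → Vec d) : ℝ :=
  (∫ x in U, inner ℝ (f x) (zeroExt v x)) +
    ∫ x in G.ΓT, inner ℝ (trace v x) (p • outwardNormal U x) ∂(surf d)

end Forms

variable {d : ℕ}

/-- Hypothesis (H): a multiplier in `W_h` that is orthogonal to the traces of all the elements of
`V_h⁺` and of `V_h⁻` vanishes. -/
def HypothesisH (G : CrackedDomain d) (F : FiniteElements G.Ω) (M : MultiplierSpace G) : Prop :=
  ∀ m ∈ M.Wh, (∀ v ∈ Vp G F, b0 G m v = 0) → (∀ v ∈ Vm G F, b0 G m v = 0) → m = 0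

/-- The three equations of the discrete fictitious domain problem. -/
def IsDiscreteSolution (G : CrackedDomain d) (F : FiniteElements G.Ω) (M : MultiplierSpace G)
    (lam mu : ℝ) (f : Vec d → Vec d) (p : ℝ)
    (up : G.Ωp → Vec d) (um : G.Ωm → Vec d) (l : Lp (Vec d) 2 G.surfΓ0) : Prop :=
  (∀ v ∈ Vp G F, a0 lam mu up v + b0 G l v = load G f p v) ∧
  (∀ v ∈ Vm G F, a0 lam mu um v - b0 G l v = load G f p v) ∧
  (∀ m ∈ M.Wh, b0 G m up - b0 G m um = 0)

end

end CrackFEM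

/-! The problem is a square linear system in finite dimension, so it suffices that the homogeneous
system has only the zero solution (`existsUnique_saddle_point`). Testing it with its own solution
cancels the multiplier terms and leaves two nonnegative energies with sum zero. If `a0` is definite,
both displacements vanish, and (H) then kills the multiplier.

Definiteness (`eq_zero_of_a0_self`) is obtained without Korn's inequality. Zero energy means zero
strain inside every cell. Integrating along almost every segment gives `⟪u x - u y, x - y⟫ = 0` on
balls (`inner_sub_sub_eq_zero_of_piecewise`), which forces `u` to be affine with skew linear part
there (`exists_skew_of_inner_sub_sub_eq_zero`). Analytic continuation over the connected subdomain
yields a single rigid motion. A nonzero one vanishes at most on an affine subspace of dimension `d -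
2`, which is null for the surface measure, so clamping makes it zero (`eq_zero_of_surf_pos`).

The remaining work is to see that the integrals are linear in the discrete functions, which requires
integrability. The delicate point is the measurability of the normal: `normalGraph_unique` and the
Lusin–Souslin theorem supply it. -/

namespace CrackFEM

/-! ### Rigidity of continuous, piecewise differentiable fields with zero strain -/

section Rigidity

variable {E : Type*} [NormedAddCommGroup E] [InnerProductSpace ℝ E]

/-- If a line meets the frontier of a closed convex set in a null set only, then it meets it in
finitely many points. -/
lemma finite_line_inter_frontier {T : Set E} (hT : Convex ℝ T) (hc : IsClosed T) {z e : E}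
    (hnull : ∀ᵐ t : ℝ, z + t • e ∉ frontier T) : {t : ℝ | z + t • e ∈ frontier T}.Finite := by
  -- Take three frontier points on the line. Between the first two lies a point off the frontier,
  -- hence interior by convexity; joining it to the third makes the middle one interior.
  by_contra hinf
  obtain ⟨s, hs, hcard⟩ := (show Set.Infinite _ from hinf).exists_subset_card_eq 3
  let o := s.orderEmbOfFin hcard
  have ho : ∀ i, z + o i • e ∈ frontier T := fun i => hs (s.orderEmbOfFin_mem hcard i)
  have h01 : o 0 < o 1 := o.strictMono (by decide)
  have h12 : o 1 < o 2 := o.strictMono (by decide)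
  have hfr : ∀ {x}, x ∈ frontier T → x ∈ T := fun hx => hc.frontier_subset hx
  have hconv : ∀ {a t b : ℝ}, a < t → t < b → z + t • e ∈ openSegment ℝ (z + a • e) (z + b • e) := by
    intro a t b h1 h2
    have hab : 0 < b - a := by linarith
    refine ⟨(b - t) / (b - a), (t - a) / (b - a), div_pos (by linarith) hab,
      div_pos (by linarith) hab, by field_simp; ring, ?_⟩
    have h3 : (b - t) / (b - a) + (t - a) / (b - a) = 1 := by field_simp; ring
    have h4 : (b - t) / (b - a) * a + (t - a) / (b - a) * b = t := by field_simp; ring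
    calc _ = ((b - t) / (b - a) + (t - a) / (b - a)) • z
          + ((b - t) / (b - a) * a + (t - a) / (b - a) * b) • e := by module
      _ = _ := by rw [h3, h4, one_smul]
  obtain ⟨t, ht, htn⟩ := (Measure.dense_of_ae hnull).inter_open_nonempty _ isOpen_Ioo
    (nonempty_Ioo.2 h01)
  have htT : z + t • e ∈ T :=
    hT.openSegment_subset (hfr (ho 0)) (hfr (ho 1)) (hconv ht.1 ht.2)
  have hti : z + t • e ∈ interior T := by
    by_contra h
    exact htn (by rw [hc.frontier_eq]; exact ⟨htT, h⟩)
  have := hT.openSegment_interior_self_subset_interior hti (hfr (ho 2)) (hconv ht.2 h12)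
  exact (ho 1).2 this

variable [FiniteDimensional ℝ E]

section Measure

variable [MeasurableSpace E] [BorelSpace E]

/-- Fubini: for each fixed `t` the bad `z` form a translate of `N`. -/
lemma ae_line_notMem {μ : Measure E} [μ.IsAddHaarMeasure] {N : Set E} (hN : MeasurableSet N)
    (h0 : μ N = 0) (e : E) : ∀ᵐ z ∂μ, ∀ᵐ t : ℝ, z + t • e ∉ N := by
  have hm : MeasurableSet {x : E × ℝ | x.1 + x.2 • e ∉ N} := by
    have : Measurable fun x : E × ℝ => x.1 + x.2 • e := by fun_prop
    exact this hN.compl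
  rw [Measure.ae_ae_comm hm]
  refine ae_of_all _ fun t => ?_
  rw [ae_iff]
  have : {a : E | ¬ (a + t • e ∉ N)} = (fun a => a + t • e) ⁻¹' N := by ext; simp
  rw [this, measure_preimage_add_right, h0]

/-- A continuous field whose symmetric gradient vanishes inside finitely many convex pieces is an
infinitesimal isometry. -/
lemma inner_sub_sub_eq_zero_of_piecewise {u : E → E} {B : Set E} (hB : IsOpen B)
    (hBc : Convex ℝ B) {S : Finset (Set E)} (hS : ∀ T ∈ S, Convex ℝ T ∧ IsClosed T)
    (hcov : B ⊆ ⋃ T ∈ S, T) (hu : ContinuousOn u B)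
    (hd : ∀ T ∈ S, ∀ x ∈ B ∩ interior T,
      DifferentiableAt ℝ u x ∧ ∀ w, inner ℝ (fderiv ℝ u x w) w = 0)
    {x y : E} (hx : x ∈ B) (hy : y ∈ B) : inner ℝ (u x - u y) (x - y) = 0 := by
  set e := x - y with he
  let O : Set E := B ∩ (fun z => z + e) ⁻¹' B
  have hO : IsOpen O := hB.inter (hB.preimage (by fun_prop))
  let μ : Measure E := Measure.addHaar
  have hgood : ∀ᵐ z ∂μ, ∀ T ∈ S, ∀ᵐ t : ℝ, z + t • e ∉ frontier T := by
    refine (eventually_countable_ball S.countable_toSet).2 fun T hT => ?_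
    exact ae_line_notMem isClosed_frontier.measurableSet
      ((hS T hT).1.addHaar_frontier μ) e
  -- The segment from `y` to `x` may run inside a face of a cell. The identity is therefore proved
  -- for almost every parallel segment and extended by continuity.
  have hφ : EqOn (fun z => inner ℝ (u (z + e) - u z) e) (fun _ => (0 : ℝ)) O := by
    refine Measure.eqOn_open_of_ae_eq (μ := μ) ?_ hO ?_ continuousOn_const
    · rw [EventuallyEq, ae_restrict_iff' hO.measurableSet]
      filter_upwards [hgood] with z hz hzO
      let g : ℝ → ℝ := fun t => inner ℝ (u (z + t • e)) e
      have hmaps : ∀ t ∈ Icc (0 : ℝ) 1, z + t • e ∈ B := by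
        intro t ht
        have := hBc hzO.1 hzO.2 (sub_nonneg.2 ht.2) ht.1 (by ring)
        convert this using 1
        simp only
        module
      have hcount : (⋃ T ∈ S, {t : ℝ | z + t • e ∈ frontier T}).Countable :=
        S.countable_toSet.biUnion fun T hT =>
          (finite_line_inter_frontier (hS T hT).1 (hS T hT).2 (hz T hT)).countable
      -- The derivative of `g` is `⟪Du e, e⟫ = 0` except at the finitely many crossings of cell
      -- frontiers, and `g` is continuous there.
      have hint := integral_eq_of_hasDerivAt_off_countable g (fun _ => 0) (a := 0) (b := 1) hcount
        ?_ ?_ (by simp)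
      · simp only [intervalIntegral.integral_zero, g, one_smul, zero_smul, add_zero] at hint
        rw [inner_sub_left, ← hint]
      · rw [uIcc_of_le zero_le_one]
        refine ContinuousOn.inner ?_ continuousOn_const
        exact hu.comp (by fun_prop) hmaps
      · rintro t ⟨ht, htn⟩
        simp only [zero_le_one, inf_of_le_left, sup_of_le_right] at ht
        have htB := hmaps t ⟨ht.1.le, ht.2.le⟩
        obtain ⟨T, hT, htT⟩ : ∃ T ∈ S, z + t • e ∈ T := by simpa using hcov htB
        have hti : z + t • e ∈ interior T := by
          by_contra h
          refine htn (mem_biUnion (show T ∈ (S : Set (Set E)) from hT) ?_)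
          change z + t • e ∈ frontier T
          rw [(hS T hT).2.frontier_eq]
          exact ⟨htT, h⟩
        obtain ⟨h1, h2⟩ := hd T hT _ ⟨htB, hti⟩
        have hl : HasDerivAt (fun t : ℝ => z + t • e) e t := by
          simpa using ((hasDerivAt_id t).smul_const e).const_add z
        have h3 : HasDerivAt (fun t : ℝ => u (z + t • e)) (fderiv ℝ u (z + t • e) e) t :=
          h1.hasFDerivAt.comp_hasDerivAt t hl
        have h4 := h3.inner ℝ (hasDerivAt_const t e)
        simpa [h2 e, g] using h4
    · refine ContinuousOn.inner (ContinuousOn.sub ?_ (hu.mono inter_subset_left)) continuousOn_const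
      exact hu.comp (by fun_prop) fun z hz => hz.2
  have := hφ (x := y) ⟨hy, by simpa [he] using hx⟩
  simpa [he] using this

end Measure

/-- An infinitesimal isometry on a ball is an infinitesimal rigid motion. -/
lemma exists_skew_of_inner_sub_sub_eq_zero {u : E → E} {c : E} {r : ℝ} (hr : 0 < r)
    (h : ∀ x ∈ Metric.ball c r, ∀ y ∈ Metric.ball c r, inner ℝ (u x - u y) (x - y) = 0) :
    ∃ A : E →L[ℝ] E, (∀ z, inner ℝ (A z) z = 0) ∧
      ∀ x ∈ Metric.ball c r, u x = u c + A (x - c) := by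
  let w : E → E := fun z => u (c + z) - u c
  have hball : ∀ z : E, ‖z‖ < r → c + z ∈ Metric.ball c r := fun z hz => by simpa using hz
  have hc : c ∈ Metric.ball c r := Metric.mem_ball_self hr
  have hw0 : ∀ z : E, ‖z‖ < r → inner ℝ (w z) z = 0 := fun z hz => by
    simpa [w] using h _ (hball z hz) _ hc
  have hw : ∀ z z' : E, ‖z‖ < r → ‖z'‖ < r → inner ℝ (w z) z' = - inner ℝ (w z') z := by
    intro z z' hz hz'
    have h1 := h _ (hball z hz) _ (hball z' hz')
    have h2 : u (c + z) - u (c + z') = w z - w z' := by simp [w]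
    have h3 : c + z - (c + z') = z - z' := by abel
    rw [h2, h3, inner_sub_left, inner_sub_right, inner_sub_right, hw0 z hz, hw0 z' hz'] at h1
    linarith
  let b := stdOrthonormalBasis ℝ E
  let s : ℝ := r / 2
  have hs : 0 < s := by positivity
  have hsb : ∀ i, ‖s • b i‖ < r := fun i => by
    rw [norm_smul, b.orthonormal.1 i, Real.norm_of_nonneg hs.le]
    simp only [s]
    linarith
  -- By the antisymmetry `hw`, the coordinate `⟪w z, b i⟫` equals `-s⁻¹ * ⟪w (s • b i), z⟫`, which
  -- is linear in `z`. The factor `s = r / 2` keeps `s • b i` in the ball.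
  let A : E →L[ℝ] E := ∑ i, ((-s⁻¹) • innerSL ℝ (w (s • b i))).smulRight (b i)
  have hA : ∀ z : E, ‖z‖ < r → w z = A z := by
    intro z hz
    rw [← b.sum_repr' (w z)]
    simp only [A, FunLike.coe_sum, Finset.sum_apply, ContinuousLinearMap.smulRight_apply]
    refine Finset.sum_congr rfl fun i _ => ?_
    congr 1
    have h1 := hw z (s • b i) hz (hsb i)
    rw [real_inner_smul_right] at h1
    have h2 : inner ℝ (b i) (w z) = s⁻¹ * (s * inner ℝ (w z) (b i)) := by
      rw [← mul_assoc, inv_mul_cancel₀ hs.ne', one_mul, real_inner_comm]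
    rw [h2, h1]
    simp
  refine ⟨A, fun z => ?_, fun x hx => ?_⟩
  · by_cases hz : z = 0
    · simp [hz]
    have hzn : 0 < ‖z‖ := norm_pos_iff.2 hz
    have hk : ‖(s / ‖z‖) • z‖ < r := by
      rw [norm_smul, Real.norm_of_nonneg (by positivity), div_mul_cancel₀ _ hzn.ne']
      simp only [s]
      linarith
    have h1 := hw0 _ hk
    rw [hA _ hk, map_smul, real_inner_smul_left, real_inner_smul_right] at h1
    have h2 : s / ‖z‖ ≠ 0 := by positivity
    simpa [h2] using h1
  · have := hA (x - c) (by simpa [dist_eq_norm] using hx)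
    simp only [w, add_sub_cancel] at this
    rw [← this]
    abel

/-- If `A z ≠ 0`, then `z` and `A z` are independent modulo the kernel: apply `A` to a relation and
pair with `z`, which isolates `‖A z‖²`. -/
lemma finrank_ker_add_two_le_of_skew {A : E →L[ℝ] E} (hA : ∀ z, inner ℝ (A z) z = 0)
    (h0 : A ≠ 0) : Module.finrank ℝ (LinearMap.ker A.toLinearMap) + 2 ≤ Module.finrank ℝ E := by
  have hsk : ∀ z z', inner ℝ (A z) z' = - inner ℝ (A z') z := by
    intro z z'
    have := hA (z + z')
    rw [map_add, inner_add_left, inner_add_right, inner_add_right, hA, hA] at this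
    linarith
  obtain ⟨z, hz⟩ : ∃ z, A z ≠ 0 := by
    by_contra! h
    exact h0 (ContinuousLinearMap.ext h)
  have hn : inner ℝ (A z) (A z) ≠ (0 : ℝ) := inner_self_ne_zero.2 hz
  have hAA : inner ℝ (A (A z)) z = - inner ℝ (A z) (A z) := hsk _ _
  let f : LinearMap.ker A.toLinearMap × (ℝ × ℝ) →ₗ[ℝ] E :=
    LinearMap.coprod (Submodule.subtype _)
      (LinearMap.coprod (LinearMap.toSpanSingleton ℝ E z) (LinearMap.toSpanSingleton ℝ E (A z)))
  have hf : Function.Injective f := by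
    rw [injective_iff_map_eq_zero]
    rintro ⟨⟨k, hk⟩, a, b⟩ h
    have hk' : A k = 0 := hk
    simp only [f, LinearMap.coprod_apply, Submodule.subtype_apply,
      LinearMap.toSpanSingleton_apply] at h
    have h1 : a • A z + b • A (A z) = 0 := by
      have := congrArg A h
      simpa [hk'] using this
    have hb : b = 0 := by
      have := congrArg (fun v => inner ℝ v z) h1
      simp only [inner_add_left, real_inner_smul_left, hA, hAA, inner_zero_left] at this
      have h2 : b * inner ℝ (A z) (A z) = 0 := by linarith
      exact (mul_eq_zero.1 h2).resolve_right hn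
    have ha : a = 0 := by
      rw [hb, zero_smul, add_zero] at h1
      exact (smul_eq_zero.1 h1).resolve_right hz
    subst ha hb
    simpa using h
  have := LinearMap.finrank_le_finrank_of_injective hf
  simpa using this

end Rigidity

/-- An infinitesimal rigid motion which vanishes on a set of positive surface measure is trivial. -/
lemma eq_zero_of_surf_pos {d : ℕ} (hd : 2 ≤ d) {A : Vec d →L[ℝ] Vec d}
    (hA : ∀ z, inner ℝ (A z) z = 0) {b c : Vec d} {K : Set (Vec d)} (hK : 0 < surf d K)
    (h : ∀ x ∈ K, b + A (x - c) = 0) (x : Vec d) : b + A (x - c) = 0 := by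
  obtain ⟨x₀, hx₀⟩ : K.Nonempty := nonempty_of_measure_ne_zero hK.ne'
  by_cases h0 : A = 0
  · simpa [h0] using h x₀ hx₀
  exfalso
  let k := LinearMap.ker A.toLinearMap
  have hfin : Module.finrank ℝ k + 2 ≤ d := by
    simpa using finrank_ker_add_two_le_of_skew hA h0
  have hi : Isometry (fun z : k => (z : Vec d) + x₀) :=
    (isometry_add_right x₀).comp isometry_subtype_coe
  have hsub : K ⊆ (fun z : k => (z : Vec d) + x₀) '' univ := by
    intro y hy
    refine ⟨⟨y - x₀, ?_⟩, mem_univ _, by simp⟩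
    change A (y - x₀) = 0
    have h1 := h y hy
    have h2 := h x₀ hx₀
    have h3 : y - x₀ = (y - c) - (x₀ - c) := by abel
    rw [h3, map_sub, eq_neg_of_add_eq_zero_right h1, eq_neg_of_add_eq_zero_right h2, sub_self]
  -- `K` lies in a translate of the kernel, of dimension at most `d - 2`.
  have hdim : dimH K < ((d - 1 : ℕ) : NNReal) := by
    refine (dimH_mono hsub).trans_lt ?_
    rw [hi.dimH_image, Real.dimH_univ_eq_finrank]
    have : Module.finrank ℝ k < d - 1 := by omega
    exact_mod_cast this
  have := hausdorffMeasure_of_dimH_lt hdim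
  refine hK.ne' ?_
  rw [surf, Measure.euclideanHausdorffMeasure_def, Measure.smul_apply]
  simp only [NNReal.coe_natCast] at this
  rw [this, smul_zero]

/-! ### Uniqueness and measurability of the outward normal -/

section Normal

variable {d : ℕ}

/-- The pairs `(x, n)` such that `n` is an outward unit normal of `U` at `x`, as far as the balls of
radius `1 / (k + 1)` can tell. -/
def normalGraph (U : Set (Vec d)) : Set (Vec d × Vec d) :=
  {q | ‖q.2‖ = 1 ∧
    Tendsto (fun k : ℕ => volume.real ((Metric.ball q.1 (1 / ((k : ℝ) + 1)) ∩ U) ∩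
      {y | 0 ≤ inner ℝ (y - q.1) q.2}) / (1 / ((k : ℝ) + 1)) ^ d) atTop (𝓝 0) ∧
    Tendsto (fun k : ℕ => volume.real ((Metric.ball q.1 (1 / ((k : ℝ) + 1)) \ U) ∩
      {y | inner ℝ (y - q.1) q.2 ≤ 0}) / (1 / ((k : ℝ) + 1)) ^ d) atTop (𝓝 0)}

lemma IsOutwardUnitNormal.mem_normalGraph {U : Set (Vec d)} {x n : Vec d}
    (h : IsOutwardUnitNormal U x n) : (x, n) ∈ normalGraph U := by
  have hr : Tendsto (fun k : ℕ => 1 / ((k : ℝ) + 1)) atTop (𝓝[>] 0) :=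
    tendsto_nhdsWithin_iff.2 ⟨tendsto_one_div_add_atTop_nhds_zero_nat,
      Eventually.of_forall fun k => mem_Ioi.2 Nat.one_div_pos_of_nat⟩
  exact ⟨h.1, h.2.1.comp hr, h.2.2.comp hr⟩

/-- With a sequence of radii, convergence is a countable condition, and each volume is the measure
of a section of a measurable set, hence measurable in `(x, n)`. -/
lemma measurableSet_normalGraph {U : Set (Vec d)} (hU : MeasurableSet U) :
    MeasurableSet (normalGraph U) := by
  have hb : ∀ r : ℝ, MeasurableSet {z : (Vec d × Vec d) × Vec d | z.2 ∈ Metric.ball z.1.1 r} :=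
    fun r => (isOpen_lt (by fun_prop : Continuous fun z : (Vec d × Vec d) × Vec d =>
      dist z.2 z.1.1) continuous_const).measurableSet
  have hUm : MeasurableSet {z : (Vec d × Vec d) × Vec d | z.2 ∈ U} := measurable_snd hU
  have hi : Continuous fun z : (Vec d × Vec d) × Vec d => inner ℝ (z.2 - z.1.1) z.1.2 := by
    fun_prop
  have h1 : MeasurableSet {z : (Vec d × Vec d) × Vec d | 0 ≤ inner ℝ (z.2 - z.1.1) z.1.2} :=
    (isClosed_le continuous_const hi).measurableSet
  have h2 : MeasurableSet {z : (Vec d × Vec d) × Vec d | inner ℝ (z.2 - z.1.1) z.1.2 ≤ 0} :=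
    (isClosed_le hi continuous_const).measurableSet
  refine MeasurableSet.inter ?_ (MeasurableSet.inter ?_ ?_)
  · exact (isClosed_eq (by fun_prop : Continuous fun q : Vec d × Vec d => ‖q.2‖)
      continuous_const).measurableSet
  · refine measurableSet_tendsto _ fun k => Measurable.div_const ?_ _
    exact (measurable_measure_prodMk_left (((hb _).inter hUm).inter h1)).ennreal_toReal
  · refine measurableSet_tendsto _ fun k => Measurable.div_const ?_ _
    exact (measurable_measure_prodMk_left (((hb _).diff hUm).inter h2)).ennreal_toReal

/-- If `m ≠ n`, the open wedge where `⟪·, m⟫ > 0` and `⟪·, n⟫ < 0` would have to be asymptotically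
free of `U` because of `m` and of its complement because of `n`, yet it fills a fixed positive
fraction of every small ball. -/
lemma normalGraph_unique {U : Set (Vec d)} {x m n : Vec d} (hm : (x, m) ∈ normalGraph U)
    (hn : (x, n) ∈ normalGraph U) : m = n := by
  by_contra hne
  obtain ⟨hm1, hm2, -⟩ := hm
  obtain ⟨hn1, -, hn3⟩ := hn
  simp only at hm1 hm2 hn1 hn3
  have hlt : inner ℝ m n < (1 : ℝ) := (inner_lt_one_iff_real_of_norm_eq_one hm1 hn1).2 hne
  let C : Set (Vec d) := {y | 0 < inner ℝ (y - x) m ∧ inner ℝ (y - x) n < 0} ∩ Metric.ball x 1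
  have hCo : IsOpen C := by
    refine IsOpen.inter (IsOpen.inter ?_ ?_) Metric.isOpen_ball
    · exact isOpen_lt (f := fun _ => (0 : ℝ)) (g := fun y => inner ℝ (y - x) m)
        (by fun_prop) (by fun_prop)
    · exact isOpen_lt (f := fun y => inner ℝ (y - x) n) (g := fun _ => (0 : ℝ))
        (by fun_prop) (by fun_prop)
  have hCne : C.Nonempty := by
    -- The products with `m` and `n` are `±(1 - ⟪m, n⟫) / 3`, and the factor `1 / 3` keeps the norm
    -- at most `2 / 3`.
    refine ⟨x + (1 / 3 : ℝ) • (m - n), ⟨?_, ?_⟩, ?_⟩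
    · rw [add_sub_cancel_left, real_inner_smul_left, inner_sub_left, real_inner_self_eq_norm_sq,
        hm1, real_inner_comm]
      linarith
    · rw [add_sub_cancel_left, real_inner_smul_left, inner_sub_left, real_inner_self_eq_norm_sq,
        hn1]
      linarith
    · rw [Metric.mem_ball, dist_eq_norm, add_sub_cancel_left, norm_smul]
      have := norm_sub_le m n
      rw [Real.norm_of_nonneg (by norm_num)]
      linarith
  have hCfin : volume C ≠ ⊤ :=
    (measure_mono inter_subset_right |>.trans_lt Metric.isBounded_ball.measure_lt_top).ne
  have hV : 0 < volume.real C :=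
    ENNReal.toReal_pos (hCo.measure_pos volume hCne).ne' hCfin
  have hle : ∀ r : ℝ, 0 < r → volume.real C ≤
      volume.real ((Metric.ball x r ∩ U) ∩ {y | 0 ≤ inner ℝ (y - x) m}) / r ^ d +
      volume.real ((Metric.ball x r \ U) ∩ {y | inner ℝ (y - x) n ≤ 0}) / r ^ d := by
    intro r hr
    have hfin : ∀ s ⊆ Metric.ball x r, volume s ≠ ⊤ := fun s hs =>
      (measure_mono hs |>.trans_lt Metric.isBounded_ball.measure_lt_top).ne
    have himg : AffineMap.homothety x r '' C ⊆
        ((Metric.ball x r ∩ U) ∩ {y | 0 ≤ inner ℝ (y - x) m}) ∪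
          ((Metric.ball x r \ U) ∩ {y | inner ℝ (y - x) n ≤ 0}) := by
      rintro _ ⟨y, ⟨⟨hy1, hy2⟩, hy3⟩, rfl⟩
      have hsub : AffineMap.homothety x r y - x = r • (y - x) := by
        simp [AffineMap.homothety_apply]
      have hyb : AffineMap.homothety x r y ∈ Metric.ball x r := by
        rw [Metric.mem_ball, dist_eq_norm, hsub, norm_smul, Real.norm_of_nonneg hr.le]
        rw [Metric.mem_ball, dist_eq_norm] at hy3
        nlinarith
      have hi1 : 0 ≤ inner ℝ (AffineMap.homothety x r y - x) m := by
        rw [hsub, real_inner_smul_left]; positivity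
      have hi2 : inner ℝ (AffineMap.homothety x r y - x) n ≤ 0 := by
        rw [hsub, real_inner_smul_left]
        exact mul_nonpos_of_nonneg_of_nonpos hr.le hy2.le
      by_cases hyU : AffineMap.homothety x r y ∈ U
      · exact Or.inl ⟨⟨hyb, hyU⟩, hi1⟩
      · exact Or.inr ⟨⟨hyb, hyU⟩, hi2⟩
    have hvol : volume.real (AffineMap.homothety x r '' C) = r ^ d * volume.real C := by
      rw [Measure.real, Measure.addHaar_image_homothety, ENNReal.toReal_mul,
        ENNReal.toReal_ofReal (abs_nonneg _), finrank_euclideanSpace_fin,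
        abs_of_nonneg (by positivity)]
      rfl
    rw [← add_div, le_div_iff₀ (by positivity), mul_comm, ← hvol]
    refine (measureReal_mono himg ?_).trans (measureReal_union_le _ _)
    exact hfin _ (union_subset (fun y hy => hy.1.1) (fun y hy => hy.1.1))
  have hlim := hm2.add hn3
  rw [add_zero] at hlim
  have := ge_of_tendsto' hlim fun k => hle (1 / ((k : ℝ) + 1)) Nat.one_div_pos_of_nat
  linarith

lemma norm_outwardNormal_le (U : Set (Vec d)) (x : Vec d) : ‖outwardNormal U x‖ ≤ 1 := by
  unfold outwardNormal
  split_ifs with h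
  · exact h.choose_spec.1.le
  · simp

-- By uniqueness the projection of `normalGraph U` to the base point is injective, so the
-- Lusin–Souslin theorem makes the projections of its Borel subsets Borel. The selection `g` is thus
-- Borel, and it agrees with `outwardNormal U` wherever a normal exists.
open Classical in
lemma aemeasurable_outwardNormal {U : Set (Vec d)} (hU : MeasurableSet U) {μ : Measure (Vec d)}
    (h : ∀ᵐ x ∂μ, ∃ n, IsOutwardUnitNormal U x n) : AEMeasurable (outwardNormal U) μ := by
  let g : Vec d → Vec d := fun x => if h : ∃ n, (x, n) ∈ normalGraph U then h.choose else 0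
  have hg : ∀ x n, (x, n) ∈ normalGraph U → g x = n := by
    intro x n hn
    have h : ∃ n, (x, n) ∈ normalGraph U := ⟨n, hn⟩
    simp only [g, dif_pos h]
    exact normalGraph_unique h.choose_spec hn
  have hproj : ∀ S ⊆ normalGraph U, MeasurableSet S → MeasurableSet (Prod.fst '' S) := by
    intro S hS hSm
    refine hSm.image_of_measurable_injOn measurable_fst ?_
    rintro ⟨x, m⟩ hm ⟨y, n⟩ hn hxy
    simp only at hxy
    subst hxy
    rw [normalGraph_unique (hS hm) (hS hn)]
  refine ⟨g, fun B hB => ?_, ?_⟩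
  · have hpre : g ⁻¹' B = Prod.fst '' (normalGraph U ∩ Prod.snd ⁻¹' B) ∪
        ((Prod.fst '' normalGraph U)ᶜ ∩ {_x | (0 : Vec d) ∈ B}) := by
      ext x
      by_cases hx : ∃ n, (x, n) ∈ normalGraph U
      · obtain ⟨n, hn⟩ := hx
        simp only [mem_preimage, hg x n hn, mem_union, mem_image, mem_inter_iff, mem_compl_iff]
        constructor
        · exact fun hnB => Or.inl ⟨(x, n), ⟨hn, hnB⟩, rfl⟩
        · rintro (⟨⟨y, m⟩, ⟨hm, hmB⟩, rfl⟩ | ⟨hx, -⟩)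
          · rwa [normalGraph_unique hn hm]
          · exact absurd ⟨(x, n), hn, rfl⟩ hx
      · have h1 : g x = 0 := dif_neg hx
        have h2 : x ∉ Prod.fst '' normalGraph U := by
          rintro ⟨⟨y, n⟩, hn, rfl⟩
          exact hx ⟨n, hn⟩
        have h3 : x ∉ Prod.fst '' (normalGraph U ∩ Prod.snd ⁻¹' B) :=
          fun h => h2 (image_mono inter_subset_left h)
        simp only [mem_preimage, h1, mem_union, mem_inter_iff, mem_compl_iff, h2, h3, false_or,
          not_false_iff, true_and, mem_ofPred_eq]
    rw [hpre]
    exact (hproj _ inter_subset_left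
      ((measurableSet_normalGraph hU).inter (measurable_snd hB))).union
      ((hproj _ subset_rfl (measurableSet_normalGraph hU)).compl.inter (MeasurableSet.const _))
  · filter_upwards [h] with x hx
    rw [hg x _ hx.choose_spec.mem_normalGraph, outwardNormal, dif_pos hx]

end Normal

/-! ### Finite dimensionality of the discrete spaces -/

section Cells

variable {d : ℕ} {Ω : Set (Vec d)} (F : FiniteElements Ω)

lemma FiniteElements.convex_cell {T : Set (Vec d)} (hT : T ∈ F.cells) : Convex ℝ T := by
  obtain ⟨s, rfl⟩ := F.polytope T hT
  exact convex_convexHull ℝ _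

lemma FiniteElements.isCompact_cell {T : Set (Vec d)} (hT : T ∈ F.cells) : IsCompact T := by
  obtain ⟨s, rfl⟩ := F.polytope T hT
  exact s.finite_toSet.isCompact_convexHull ℝ

lemma FiniteElements.subset_iUnion_cells : Ω ⊆ ⋃ T ∈ F.cells, T :=
  F.cover ▸ subset_closure

/-- The space of the restrictions to `closure Ω ∩ T` of the elements of `P T`. -/
noncomputable def FiniteElements.cellSpace (T : Set (Vec d)) :
    Submodule ℝ ({x : closure Ω // (x : Vec d) ∈ T} → Vec d) :=
  (F.P T).map (LinearMap.funLeft ℝ (Vec d) fun x => (x.1 : Vec d))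

/-- Restriction of the elements of `Ṽ_h` to the cell `T`. -/
noncomputable def FiniteElements.toCell {T : Set (Vec d)} (hT : T ∈ F.cells) :
    F.Vtilde →ₗ[ℝ] F.cellSpace T where
  toFun v := ⟨fun x => v.1 x.1, by
    obtain ⟨q, hq, hvq⟩ := v.2.2 T hT
    exact ⟨q, hq, funext fun x => (hvq x.1 x.2).symm⟩⟩
  map_add' _ _ := rfl
  map_smul' _ _ := rfl

/-- The cells cover `closure Ω`, so a function is determined by its restrictions to them, each in an
image of `P T`. -/
instance FiniteElements.finiteDimensional_Vtilde : FiniteDimensional ℝ F.Vtilde := by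
  have : ∀ T : F.cells, FiniteDimensional ℝ (F.cellSpace (T : Set (Vec d))) := fun T => by
    have := F.finiteDimensional_P T T.2
    unfold FiniteElements.cellSpace
    infer_instance
  let Φ : F.Vtilde →ₗ[ℝ] (∀ T : F.cells, F.cellSpace (T : Set (Vec d))) :=
    LinearMap.pi fun T => F.toCell T.2
  refine Module.Finite.of_injective Φ fun v w h => Subtype.ext (ContinuousMap.ext fun x => ?_)
  obtain ⟨T, hT, hx⟩ : ∃ T ∈ F.cells, (x : Vec d) ∈ T := by
    simpa using F.cover.symm.subset x.2
  exact congrFun (congrArg Subtype.val (congrFun h ⟨T, hT⟩)) ⟨x, hx⟩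

instance MultiplierSpace.finiteDimensional_Wh {G : CrackedDomain d} (M : MultiplierSpace G) :
    FiniteDimensional ℝ M.Wh := by
  have := M.finiteDimensional_Wtilde
  let Φ : M.Wtilde →ₗ[ℝ] Lp (Vec d) 2 G.surfΓ0 :=
    { toFun := fun w => (M.memLp_Γ0 w.1 w.2).toLp w.1
      map_add' := fun _ _ => rfl
      map_smul' := fun _ _ => rfl }
  refine Submodule.finiteDimensional_of_le (S₂ := LinearMap.range Φ) ?_
  rintro g ⟨w, hw, h⟩
  exact ⟨⟨w, hw⟩, Lp.ext ((MemLp.coeFn_toLp (M.memLp_Γ0 w hw)).trans h.symm)⟩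

end Cells

/-! ### Zero extensions and traces of restrictions -/

section Restriction

variable {d : ℕ} {Ω U : Set (Vec d)}

lemma zeroExt_apply (u : U → Vec d) {x : Vec d} (hx : x ∈ U) : zeroExt u x = u ⟨x, hx⟩ :=
  Subtype.val_injective.extend_apply u 0 ⟨x, hx⟩

lemma zeroExt_add (u v : U → Vec d) : zeroExt (u + v) = zeroExt u + zeroExt v := by
  have := Function.extend_add (Subtype.val : U → Vec d) u v 0 0
  simpa [zeroExt] using this

lemma zeroExt_smul (c : ℝ) (u : U → Vec d) : zeroExt (c • u) = c • zeroExt u := by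
  have := Function.extend_smul c (Subtype.val : U → Vec d) u 0
  simpa [zeroExt] using this

/-- Since `v` is continuous on `closure Ω`, the limit from `U` exists at every point of `closure U`,
whatever the regularity of the boundary. -/
lemma trace_restrictTo (hU : U ⊆ Ω) (v : C(closure Ω, Vec d)) {x : Vec d} (hx : x ∈ closure U) :
    trace (restrictTo hU v) x = v ⟨x, closure_mono hU hx⟩ := by
  refine extendFrom_eq hx ?_
  have hlim : Tendsto (fun y : U => v ⟨y, subset_closure (hU y.2)⟩) (comap Subtype.val (𝓝 x))
      (𝓝 (v ⟨x, closure_mono hU hx⟩)) := by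
    refine (v.continuous.tendsto _).comp ?_
    rw [tendsto_subtype_rng]
    exact tendsto_comap
  rw [nhdsWithin, ← map_comap_setCoe_val, tendsto_map'_iff]
  exact hlim.congr fun y => (zeroExt_apply _ y.2).symm

lemma continuousOn_trace_restrictTo (hU : U ⊆ Ω) (v : C(closure Ω, Vec d)) :
    ContinuousOn (trace (restrictTo hU v)) (closure U) := by
  rw [continuousOn_iff_continuous_domRestrict]
  have : Continuous fun x : closure U => v ⟨x, closure_mono hU x.2⟩ := by fun_prop
  exact this.congr fun x => (trace_restrictTo hU v x.2).symm

lemma trace_eqOn_zeroExt (hU : U ⊆ Ω) (v : C(closure Ω, Vec d)) :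
    EqOn (zeroExt (restrictTo hU v)) (trace (restrictTo hU v)) U := fun x hx => by
  rw [trace_restrictTo hU v (subset_closure hx), zeroExt_apply _ hx]
  rfl

lemma memLp_trace_restrictTo (hΩ : Bornology.IsBounded Ω) (hU : U ⊆ Ω) (v : C(closure Ω, Vec d))
    {K : Set (Vec d)} (hK : MeasurableSet K) (hKU : K ⊆ closure U) {μ : Measure (Vec d)}
    (hμ : μ K < ⊤) (p : ENNReal) : MemLp (trace (restrictTo hU v)) p (μ.restrict K) := by
  have : IsFiniteMeasure (μ.restrict K) := isFiniteMeasure_restrict.2 hμ.ne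
  have : CompactSpace (closure Ω) := isCompact_iff_compactSpace.1 hΩ.isCompact_closure
  refine MemLp.of_bound
    (((continuousOn_trace_restrictTo hU v).mono hKU).aestronglyMeasurable hK) ‖v‖ ?_
  filter_upwards [ae_restrict_mem hK] with x hx
  rw [trace_restrictTo hU v (hKU hx)]
  exact v.norm_coe_le_norm _

lemma memLp_zeroExt_restrictTo (hΩ : Bornology.IsBounded Ω) (hUo : IsOpen U) (hU : U ⊆ Ω)
    (v : C(closure Ω, Vec d)) (p : ENNReal) :
    MemLp (zeroExt (restrictTo hU v)) p (volume.restrict U) := by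
  refine (memLp_trace_restrictTo hΩ hU v hUo.measurableSet subset_closure
    (hΩ.subset hU).measure_lt_top p).ae_eq ?_
  filter_upwards [ae_restrict_mem hUo.measurableSet] with x hx
  exact (trace_eqOn_zeroExt hU v hx).symm

end Restriction

/-! ### Piecewise gradients and the elastic bilinear form -/

section Gradient

variable {d : ℕ} {Ω U : Set (Vec d)} {F : FiniteElements Ω} {hU : U ⊆ Ω} {u v : U → Vec d}

lemma exists_eqOn_cell (hu : u ∈ F.Vtilde.map (restrictTo hU)) {T : Set (Vec d)}
    (hT : T ∈ F.cells) : ∃ q, ContDiffOn ℝ 1 q T ∧ EqOn (zeroExt u) q (U ∩ interior T) := by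
  obtain ⟨w, hw, rfl⟩ := hu
  obtain ⟨q, hq, hwq⟩ := hw.2 T hT
  refine ⟨q, F.contDiffOn_P T hT q hq, fun x hx => ?_⟩
  rw [zeroExt_apply _ hx.1]
  exact hwq _ (interior_subset hx.2)

lemma contDiffOn_zeroExt (hu : u ∈ F.Vtilde.map (restrictTo hU)) {T : Set (Vec d)}
    (hT : T ∈ F.cells) : ContDiffOn ℝ 1 (zeroExt u) (U ∩ interior T) := by
  obtain ⟨q, hq, hqu⟩ := exists_eqOn_cell hu hT
  exact (hq.mono (inter_subset_right.trans interior_subset)).congr hqu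

lemma differentiableAt_zeroExt (hUo : IsOpen U) (hu : u ∈ F.Vtilde.map (restrictTo hU))
    {T : Set (Vec d)} (hT : T ∈ F.cells) {x : Vec d} (hx : x ∈ U ∩ interior T) :
    DifferentiableAt ℝ (zeroExt u) x :=
  ((contDiffOn_zeroExt hu hT).differentiableOn one_ne_zero).differentiableAt
    ((hUo.inter isOpen_interior).mem_nhds hx)

/-- The derivative of `q` within the compact cell is continuous up to its boundary, hence bounded,
and is the full derivative at interior points. -/
lemma exists_norm_fderiv_le_cell (hUo : IsOpen U) (hu : u ∈ F.Vtilde.map (restrictTo hU))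
    {T : Set (Vec d)} (hT : T ∈ F.cells) :
    ∃ C, ∀ x ∈ U ∩ interior T, ‖fderiv ℝ (zeroExt u) x‖ ≤ C := by
  obtain ⟨q, hq, hqu⟩ := exists_eqOn_cell hu hT
  have hc := hq.continuousOn_fderivWithin
    (uniqueDiffOn_convex (F.convex_cell hT) (F.nonempty_interior T hT)) le_rfl
  obtain ⟨C, hC⟩ := (F.isCompact_cell hT).exists_bound_of_continuousOn hc
  refine ⟨C, fun x hx => ?_⟩
  have h1 : zeroExt u =ᶠ[𝓝 x] q :=
    hqu.eventuallyEq_of_mem ((hUo.inter isOpen_interior).mem_nhds hx)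
  rw [h1.fderiv_eq, ← fderivWithin_of_mem_nhds (mem_interior_iff_mem_nhds.1 hx.2)]
  exact hC x (interior_subset hx.2)

lemma exists_norm_fderiv_le (hUo : IsOpen U) (hu : u ∈ F.Vtilde.map (restrictTo hU)) :
    ∃ C, ∀ T ∈ F.cells, ∀ x ∈ U ∩ interior T, ‖fderiv ℝ (zeroExt u) x‖ ≤ C := by
  choose! C hC using fun T (hT : T ∈ F.cells) => exists_norm_fderiv_le_cell hUo hu hT
  obtain ⟨M, hM⟩ := (F.cells.finite_toSet.image C).bddAbove
  exact ⟨M, fun T hT x hx => (hC T hT x hx).trans (hM (mem_image_of_mem C hT))⟩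

-- Frontiers of convex sets are Lebesgue null, so statements about gradients need only be checked
-- inside the cells.
variable (F) in
lemma FiniteElements.ae_mem_interior_cell (hUo : IsOpen U) (hU : U ⊆ Ω) :
    ∀ᵐ x ∂volume.restrict U, ∃ T ∈ F.cells, x ∈ U ∩ interior T := by
  have h : ∀ᵐ x : Vec d, ∀ T ∈ F.cells, x ∉ frontier T := by
    refine (eventually_countable_ball F.cells.countable_toSet).2 fun T hT => ?_
    exact measure_eq_zero_iff_ae_notMem.1 ((F.convex_cell hT).addHaar_frontier volume)
  filter_upwards [ae_restrict_mem hUo.measurableSet, ae_restrict_of_ae h] with x hx hxT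
  obtain ⟨T, hT, hxc⟩ : ∃ T ∈ F.cells, x ∈ T := by simpa using F.subset_iUnion_cells (hU hx)
  refine ⟨T, hT, hx, ?_⟩
  by_contra hni
  refine hxT T hT ?_
  rw [(F.isCompact_cell hT).isClosed.frontier_eq]
  exact ⟨hxc, hni⟩

lemma memLp_grad (hΩ : Bornology.IsBounded Ω) (hUo : IsOpen U)
    (hu : u ∈ F.Vtilde.map (restrictTo hU)) (i j : Fin d) :
    MemLp (fun x => grad u x i j) 2 (volume.restrict U) := by
  have : IsFiniteMeasure (volume.restrict U) :=
    isFiniteMeasure_restrict.2 (hΩ.subset hU).measure_lt_top.ne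
  obtain ⟨C, hC⟩ := exists_norm_fderiv_le hUo hu
  have hm : Measurable fun x => grad u x i j :=
    (by fun_prop : Measurable fun y : Vec d => y i).comp
      (measurable_fderiv_apply_const ℝ (zeroExt u) (EuclideanSpace.single j 1))
  refine MemLp.of_bound hm.aestronglyMeasurable C ?_
  filter_upwards [F.ae_mem_interior_cell hUo hU] with x ⟨T, hT, hx⟩
  calc ‖grad u x i j‖ ≤ ‖fderiv ℝ (zeroExt u) x (EuclideanSpace.single j 1)‖ :=
        PiLp.norm_apply_le _ i
    _ ≤ ‖fderiv ℝ (zeroExt u) x‖ * ‖EuclideanSpace.single j (1 : ℝ)‖ :=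
        ContinuousLinearMap.le_opNorm _ _
    _ ≤ C := by simpa using hC T hT x hx

/-- `fderiv` is additive only where both functions are differentiable, hence the almost everywhere
statement; `grad_smul` holds at every point. -/
lemma grad_add (hUo : IsOpen U) (hu : u ∈ F.Vtilde.map (restrictTo hU))
    (hv : v ∈ F.Vtilde.map (restrictTo hU)) :
    ∀ᵐ x ∂volume.restrict U, grad (u + v) x = grad u x + grad v x := by
  filter_upwards [F.ae_mem_interior_cell hUo hU] with x ⟨T, hT, hx⟩
  ext i j
  simp [grad, zeroExt_add, fderiv_add (differentiableAt_zeroExt hUo hu hT hx)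
    (differentiableAt_zeroExt hUo hv hT hx)]

lemma grad_smul (c : ℝ) (u : U → Vec d) (x : Vec d) : grad (c • u) x = c • grad u x := by
  ext i j
  simp [grad, zeroExt_smul, fderiv_const_smul_field]

lemma strain_apply (u : U → Vec d) (x : Vec d) (i j : Fin d) :
    strain u x i j = (1 / 2) * (grad u x i j + grad u x j i) := by
  simp [strain]

lemma trace_grad (u : U → Vec d) (x : Vec d) : (grad u x).trace = ∑ k, strain u x k k := by
  simp only [Matrix.trace, Matrix.diag_apply, strain_apply]
  exact Finset.sum_congr rfl fun k _ => by ring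

lemma stress_apply (lam mu : ℝ) (u : U → Vec d) (x : Vec d) (i j : Fin d) :
    stress lam mu u x i j = 2 * mu * strain u x i j +
      lam * (∑ k, strain u x k k) * (1 : Matrix (Fin d) (Fin d) ℝ) i j := by
  simp [stress, trace_grad]

lemma trace_mul_transpose_eq_sum (A B : Matrix (Fin d) (Fin d) ℝ) :
    (A * B.transpose).trace = ∑ i, ∑ j, A i j * B i j := by
  simp [Matrix.trace, Matrix.mul_apply]

lemma memLp_strain (hΩ : Bornology.IsBounded Ω) (hUo : IsOpen U)
    (hu : u ∈ F.Vtilde.map (restrictTo hU)) (i j : Fin d) :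
    MemLp (fun x => strain u x i j) 2 (volume.restrict U) := by
  simp only [strain_apply]
  exact ((memLp_grad hΩ hUo hu i j).add (memLp_grad hΩ hUo hu j i)).const_mul _

lemma memLp_stress (hΩ : Bornology.IsBounded Ω) (hUo : IsOpen U)
    (hu : u ∈ F.Vtilde.map (restrictTo hU)) (lam mu : ℝ) (i j : Fin d) :
    MemLp (fun x => stress lam mu u x i j) 2 (volume.restrict U) := by
  simp only [stress_apply]
  refine ((memLp_strain hΩ hUo hu i j).const_mul _).add ?_
  have := (memLp_finsetSum Finset.univ fun k _ => memLp_strain hΩ hUo hu k k).const_mul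
    (lam * (1 : Matrix (Fin d) (Fin d) ℝ) i j)
  convert this using 2
  ring

lemma integrable_energy (hΩ : Bornology.IsBounded Ω) (hUo : IsOpen U)
    (hu : u ∈ F.Vtilde.map (restrictTo hU)) (hv : v ∈ F.Vtilde.map (restrictTo hU))
    (lam mu : ℝ) :
    IntegrableOn (fun x => (stress lam mu u x * (strain v x).transpose).trace) U := by
  simp only [trace_mul_transpose_eq_sum]
  exact integrable_finsetSum _ fun i _ => integrable_finsetSum _ fun j _ =>
    (memLp_stress hΩ hUo hu lam mu i j).integrable_mul (memLp_strain hΩ hUo hv i j)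

lemma strain_of_grad_add {w : U → Vec d} {x : Vec d} (h : grad w x = grad u x + grad v x) :
    strain w x = strain u x + strain v x := by
  simp only [strain, h, Matrix.transpose_add]
  module

lemma stress_of_grad_add {w : U → Vec d} {x : Vec d} (h : grad w x = grad u x + grad v x)
    (lam mu : ℝ) : stress lam mu w x = stress lam mu u x + stress lam mu v x := by
  simp only [stress, strain_of_grad_add h, h, Matrix.trace_add]
  module

lemma strain_smul (c : ℝ) (u : U → Vec d) (x : Vec d) : strain (c • u) x = c • strain u x := by
  simp only [strain, grad_smul, Matrix.transpose_smul]
  module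

lemma stress_smul (lam mu c : ℝ) (u : U → Vec d) (x : Vec d) :
    stress lam mu (c • u) x = c • stress lam mu u x := by
  simp only [stress, strain_smul, grad_smul, Matrix.trace_smul, smul_eq_mul]
  module

/-- `a₀` as a bilinear form on `V_h`. -/
noncomputable def a0Form (F : FiniteElements Ω) (hΩ : Bornology.IsBounded Ω) (hUo : IsOpen U)
    (hU : U ⊆ Ω) (lam mu : ℝ) :
    F.Vtilde.map (restrictTo hU) →ₗ[ℝ] F.Vtilde.map (restrictTo hU) →ₗ[ℝ] ℝ :=
  LinearMap.mk₂ ℝ (fun u v => a0 lam mu u.1 v.1)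
    (fun u u' v => by
      unfold a0
      rw [← integral_add (integrable_energy hΩ hUo u.2 v.2 lam mu)
        (integrable_energy hΩ hUo u'.2 v.2 lam mu)]
      refine integral_congr_ae ?_
      filter_upwards [grad_add hUo u.2 u'.2] with x hx
      simp only [Submodule.coe_add, stress_of_grad_add hx, add_mul, Matrix.trace_add])
    (fun c u v => by
      simp only [a0, Submodule.coe_smul, stress_smul, smul_mul_assoc, Matrix.trace_smul,
        smul_eq_mul, integral_const_mul])
    (fun u v v' => by
      unfold a0
      rw [← integral_add (integrable_energy hΩ hUo u.2 v.2 lam mu)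
        (integrable_energy hΩ hUo u.2 v'.2 lam mu)]
      refine integral_congr_ae ?_
      filter_upwards [grad_add hUo v.2 v'.2] with x hx
      simp only [Submodule.coe_add, strain_of_grad_add hx, Matrix.transpose_add, mul_add,
        Matrix.trace_add])
    (fun c u v => by
      simp only [a0, Submodule.coe_smul, strain_smul, Matrix.transpose_smul, mul_smul_comm,
        Matrix.trace_smul, smul_eq_mul, integral_const_mul])

end Gradient

/-! ### Abstract saddle point problem -/

section Saddle

/-- A finite dimensional saddle point problem is well posed, if its elliptic part is definite and
its multipliers are determined by their action. -/
lemma existsUnique_saddle_point {V₁ V₂ W : Type*} [AddCommGroup V₁] [Module ℝ V₁]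
    [FiniteDimensional ℝ V₁] [AddCommGroup V₂] [Module ℝ V₂] [FiniteDimensional ℝ V₂]
    [AddCommGroup W] [Module ℝ W] [FiniteDimensional ℝ W]
    (a₁ : V₁ →ₗ[ℝ] V₁ →ₗ[ℝ] ℝ) (a₂ : V₂ →ₗ[ℝ] V₂ →ₗ[ℝ] ℝ)
    (b₁ : W →ₗ[ℝ] V₁ →ₗ[ℝ] ℝ) (b₂ : W →ₗ[ℝ] V₂ →ₗ[ℝ] ℝ)
    (l₁ : V₁ →ₗ[ℝ] ℝ) (l₂ : V₂ →ₗ[ℝ] ℝ)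
    (h₁ : ∀ u, 0 ≤ a₁ u u) (h₁' : ∀ u, a₁ u u = 0 → u = 0)
    (h₂ : ∀ u, 0 ≤ a₂ u u) (h₂' : ∀ u, a₂ u u = 0 → u = 0)
    (hb : ∀ m, (∀ v, b₁ m v = 0) → (∀ v, b₂ m v = 0) → m = 0) :
    ∃! s : V₁ × V₂ × W, (∀ v, a₁ s.1 v + b₁ s.2.2 v = l₁ v) ∧
      (∀ v, a₂ s.2.1 v - b₂ s.2.2 v = l₂ v) ∧ ∀ m, b₁ m s.1 - b₂ m s.2.1 = 0 := by
  let L : V₁ × V₂ × W →ₗ[ℝ] Module.Dual ℝ V₁ × Module.Dual ℝ V₂ × Module.Dual ℝ W :=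
    { toFun := fun s => (a₁ s.1 + b₁ s.2.2, a₂ s.2.1 - b₂ s.2.2, b₁.flip s.1 - b₂.flip s.2.1)
      map_add' := fun s t => by
        simp only [Prod.fst_add, Prod.snd_add, map_add, Prod.mk_add_mk, Prod.mk.injEq]
        exact ⟨by abel, by abel, by abel⟩
      map_smul' := fun c s => by
        simp only [Prod.smul_fst, Prod.smul_snd, map_smul, RingHom.id_apply, Prod.smul_mk,
          smul_add, smul_sub] }
  have hinj : Function.Injective L := by
    rw [injective_iff_map_eq_zero]
    rintro ⟨u, v, m⟩ h
    simp only [L, LinearMap.coe_mk, AddHom.coe_mk, Prod.mk_eq_zero] at h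
    obtain ⟨e1, e2, e3⟩ := h
    have f1 : ∀ w, a₁ u w + b₁ m w = 0 := fun w => LinearMap.congr_fun e1 w
    have f2 : ∀ w, a₂ v w - b₂ m w = 0 := fun w => LinearMap.congr_fun e2 w
    have f3 : b₁ m u - b₂ m v = 0 := LinearMap.congr_fun e3 m
    -- Adding `f1 u` and `f2 v` and using `f3` gives `a₁ u u + a₂ v v = 0`.
    have hu : u = 0 := h₁' u (by linarith [f1 u, f2 v, h₁ u, h₂ v])
    have hv : v = 0 := h₂' v (by linarith [f1 u, f2 v, h₁ u, h₂ v])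
    have hm : m = 0 := hb m (fun w => by simpa [hu] using f1 w) (fun w => by simpa [hv] using f2 w)
    rw [hu, hv, hm]
    rfl
  -- Each space has the dimension of its dual, so the system is square.
  have hsurj : Function.Surjective L :=
    (LinearMap.injective_iff_surjective_of_finrank_eq_finrank (by
      simp only [Module.finrank_prod, Subspace.dual_finrank_eq])).1 hinj
  have hiff : ∀ s, L s = (l₁, l₂, 0) ↔ ((∀ v, a₁ s.1 v + b₁ s.2.2 v = l₁ v) ∧
      (∀ v, a₂ s.2.1 v - b₂ s.2.2 v = l₂ v) ∧ ∀ m, b₁ m s.1 - b₂ m s.2.1 = 0) := by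
    intro s
    simp only [L, LinearMap.coe_mk, AddHom.coe_mk, Prod.mk.injEq, LinearMap.ext_iff]
    rfl
  obtain ⟨s, hs⟩ := hsurj (l₁, l₂, 0)
  exact ⟨s, (hiff s).1 hs, fun t ht => hinj (((hiff t).2 ht).trans hs.symm)⟩

end Saddle

/-! ### Definiteness of the elastic energy -/

section Coercivity

variable {d : ℕ} {Ω U : Set (Vec d)} {F : FiniteElements Ω} {hU : U ⊆ Ω} {u : U → Vec d}
  {lam mu : ℝ}

/-- The elastic energy density controls the strain. -/
lemma exists_le_energy (hmu : 0 < mu) (hlam : 0 < 2 * mu + d * lam) :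
    ∃ α > 0, ∀ (u : U → Vec d) (x : Vec d), α * ∑ i, ∑ j, strain u x i j ^ 2 ≤
      (stress lam mu u x * (strain u x).transpose).trace := by
  -- The density is `2 * mu * Q + lam * t ^ 2`. For `lam ≥ 0` the trace term is dropped; for `lam ≤
  -- 0` Cauchy–Schwarz, `t ^ 2 ≤ d * Q`, bounds it below.
  refine ⟨min (2 * mu) (2 * mu + d * lam), lt_min (by linarith) hlam, fun u x => ?_⟩
  set Q := ∑ i, ∑ j, strain u x i j ^ 2 with hQ
  set t := ∑ k, strain u x k k with ht
  have hQ0 : 0 ≤ Q := by positivity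
  have hE : (stress lam mu u x * (strain u x).transpose).trace = 2 * mu * Q + lam * t ^ 2 := by
    rw [trace_mul_transpose_eq_sum]
    simp only [stress_apply, ← ht, add_mul, Finset.sum_add_distrib, Matrix.one_apply, mul_ite,
      mul_one, mul_zero, ite_mul, zero_mul, Finset.sum_ite_eq, Finset.mem_univ, if_true]
    rw [← Finset.mul_sum, ← ht, hQ]
    simp only [Finset.mul_sum]
    congr 1
    · exact Finset.sum_congr rfl fun i _ => Finset.sum_congr rfl fun j _ => by ring
    · ring
  have ht2 : t ^ 2 ≤ d * Q := by
    have h1 : t ^ 2 ≤ d * ∑ k, strain u x k k ^ 2 := by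
      simpa using sq_sum_le_card_mul_sum_sq (s := Finset.univ) (f := fun k => strain u x k k)
    refine h1.trans (mul_le_mul_of_nonneg_left ?_ (Nat.cast_nonneg d))
    exact Finset.sum_le_sum fun i _ =>
      Finset.single_le_sum (f := fun j => strain u x i j ^ 2) (fun j _ => sq_nonneg _)
        (Finset.mem_univ i)
  rw [hE]
  rcases le_total 0 lam with h | h
  · have := mul_le_mul_of_nonneg_right (min_le_left (2 * mu) (2 * mu + d * lam)) hQ0
    have : 0 ≤ lam * t ^ 2 := by positivity
    linarith
  · have := mul_le_mul_of_nonneg_right (min_le_right (2 * mu) (2 * mu + d * lam)) hQ0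
    have : lam * (d * Q) ≤ lam * t ^ 2 := mul_le_mul_of_nonpos_left ht2 h
    linarith

lemma a0_self_nonneg (hmu : 0 < mu) (hlam : 0 < 2 * mu + d * lam) (u : U → Vec d) :
    0 ≤ a0 lam mu u u := by
  obtain ⟨α, hα, h⟩ := exists_le_energy (U := U) hmu hlam
  exact integral_nonneg fun x => le_trans (by positivity) (h u x)

lemma continuousOn_strain (hUo : IsOpen U) (hu : u ∈ F.Vtilde.map (restrictTo hU))
    {T : Set (Vec d)} (hT : T ∈ F.cells) (i j : Fin d) :
    ContinuousOn (fun x => strain u x i j) (U ∩ interior T) := by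
  have hc := (contDiffOn_zeroExt hu hT).continuousOn_fderiv_of_isOpen
    (hUo.inter isOpen_interior) le_rfl
  have hg : ∀ i j, ContinuousOn (fun x => grad u x i j) (U ∩ interior T) := fun i j =>
    (by fun_prop : Continuous fun y : Vec d => y i).comp_continuousOn
      (hc.clm_apply continuousOn_const)
  simp only [strain_apply]
  exact ((hg i j).add (hg j i)).const_mul _

/-- Zero energy kills the strain almost everywhere, and its continuity inside a cell upgrades this
to every point there. -/
lemma strain_eq_zero_of_a0_self (hΩ : Bornology.IsBounded Ω) (hUo : IsOpen U) (hmu : 0 < mu)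
    (hlam : 0 < 2 * mu + d * lam) (hu : u ∈ F.Vtilde.map (restrictTo hU))
    (h0 : a0 lam mu u u = 0) {T : Set (Vec d)} (hT : T ∈ F.cells) {x : Vec d}
    (hx : x ∈ U ∩ interior T) (i j : Fin d) : strain u x i j = 0 := by
  obtain ⟨α, hα, h⟩ := exists_le_energy (U := U) hmu hlam
  have hae := (integral_eq_zero_iff_of_nonneg
    (fun x => le_trans (by positivity) (h u x)) (integrable_energy hΩ hUo hu hu lam mu)).1 h0
  have hQ : EqOn (fun x => strain u x i j) (fun _ => 0) (U ∩ interior T) := by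
    refine Measure.eqOn_open_of_ae_eq (μ := volume) ?_ (hUo.inter isOpen_interior)
      (continuousOn_strain hUo hu hT i j) continuousOn_const
    refine ae_restrict_of_ae_restrict_of_subset inter_subset_left ?_
    filter_upwards [hae] with y hy
    have h1 := h u y
    simp only [Pi.zero_apply] at hy
    rw [hy] at h1
    have h2 : strain u y i j ^ 2 ≤ ∑ i, ∑ j, strain u y i j ^ 2 :=
      (Finset.single_le_sum (f := fun j => strain u y i j ^ 2) (fun _ _ => sq_nonneg _)
        (Finset.mem_univ j)).trans
      (Finset.single_le_sum (f := fun i => ∑ j, strain u y i j ^ 2)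
        (fun _ _ => Finset.sum_nonneg fun _ _ => sq_nonneg _) (Finset.mem_univ i))
    have h3 : ∑ i, ∑ j, strain u y i j ^ 2 ≤ 0 := by
      by_contra! hpos
      linarith [mul_pos hα hpos]
    exact pow_eq_zero_iff two_ne_zero |>.1 (le_antisymm (h2.trans h3) (sq_nonneg _))
  exact hQ hx

/-- The skew part of the gradient drops out of the quadratic form. This turns zero strain into the
hypothesis of `inner_sub_sub_eq_zero_of_piecewise`. -/
lemma inner_fderiv_eq_sum_strain (u : U → Vec d) (x w : Vec d) :
    inner ℝ (fderiv ℝ (zeroExt u) x w) w = ∑ i, ∑ j, strain u x i j * w j * w i := by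
  have h1 : ∀ i, fderiv ℝ (zeroExt u) x w i = ∑ j, grad u x i j * w j := by
    intro i
    have hw : w = ∑ j, w j • EuclideanSpace.single j (1 : ℝ) := by
      ext k
      simp [Pi.single_apply]
    conv_lhs => rw [hw]
    simp [grad, mul_comm]
  have h2 : ∑ i, ∑ j, grad u x j i * w j * w i = ∑ i, ∑ j, grad u x i j * w j * w i := by
    rw [Finset.sum_comm]
    exact Finset.sum_congr rfl fun i _ => Finset.sum_congr rfl fun j _ => by ring
  have h3 : ∑ i, ∑ j, strain u x i j * w j * w i = (1 / 2) *
      (∑ i, ∑ j, grad u x i j * w j * w i + ∑ i, ∑ j, grad u x j i * w j * w i) := by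
    simp only [strain_apply, Finset.mul_sum, ← Finset.sum_add_distrib]
    exact Finset.sum_congr rfl fun i _ => Finset.sum_congr rfl fun j _ => by ring
  rw [h3, h2, PiLp.inner_apply]
  simp only [h1, RCLike.inner_apply, conj_trivial, Finset.mul_sum]
  rw [← Finset.sum_add_distrib, Finset.mul_sum]
  refine Finset.sum_congr rfl fun i _ => ?_
  rw [← Finset.sum_add_distrib, Finset.mul_sum]
  refine Finset.sum_congr rfl fun j _ => ?_
  ring

/-- An element of `V_h` of zero energy is an infinitesimal rigid motion. -/
lemma exists_rigid_of_a0_self (hΩ : Bornology.IsBounded Ω) (hUo : IsOpen U) (hUc : IsConnected U)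
    (hmu : 0 < mu) (hlam : 0 < 2 * mu + d * lam) (hu : u ∈ F.Vtilde.map (restrictTo hU))
    (h0 : a0 lam mu u u = 0) :
    ∃ (A : Vec d →L[ℝ] Vec d) (b c : Vec d), (∀ z, inner ℝ (A z) z = 0) ∧
      EqOn (zeroExt u) (fun x => b + A (x - c)) U := by
  have hcont : ContinuousOn (zeroExt u) U := by
    obtain ⟨v, -, rfl⟩ := hu
    exact ((continuousOn_trace_restrictTo hU v).mono subset_closure).congr
      (trace_eqOn_zeroExt hU v)
  have hloc : ∀ c ∈ U, ∃ A : Vec d →L[ℝ] Vec d, (∀ z, inner ℝ (A z) z = 0) ∧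
      zeroExt u =ᶠ[𝓝 c] fun x => zeroExt u c + A (x - c) := by
    intro c hc
    obtain ⟨r, hr, hball⟩ := Metric.isOpen_iff.1 hUo c hc
    obtain ⟨A, hA, hAu⟩ := exists_skew_of_inner_sub_sub_eq_zero (u := zeroExt u) (c := c) hr
      fun x hx y hy => inner_sub_sub_eq_zero_of_piecewise Metric.isOpen_ball (convex_ball c r)
        (S := F.cells) (fun T hT => ⟨F.convex_cell hT, (F.isCompact_cell hT).isClosed⟩)
        ((hball.trans hU).trans F.subset_iUnion_cells) (hcont.mono hball)
        (fun T hT z hz => ⟨differentiableAt_zeroExt hUo hu hT ⟨hball hz.1, hz.2⟩, fun w => by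
          rw [inner_fderiv_eq_sum_strain]
          simp [strain_eq_zero_of_a0_self hΩ hUo hmu hlam hu h0 hT ⟨hball hz.1, hz.2⟩]⟩) hx hy
    exact ⟨A, hA, (show EqOn _ _ _ from hAu).eventuallyEq_of_mem (Metric.ball_mem_nhds c hr)⟩
  have han : ∀ (A : Vec d →L[ℝ] Vec d) (b c x : Vec d),
      AnalyticAt ℝ (fun x => b + A (x - c)) x := fun A b c x =>
    analyticAt_const.add ((A.analyticAt _).comp (analyticAt_id.sub analyticAt_const))
  obtain ⟨c, hc⟩ := hUc.nonempty
  obtain ⟨A, hA, hAu⟩ := hloc c hc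
  refine ⟨A, zeroExt u c, c, hA, ?_⟩
  -- Being locally affine, the field is analytic on `U`; the identity theorem spreads the rigid
  -- motion found near `c`.
  refine AnalyticOnNhd.eqOn_of_preconnected_of_eventuallyEq (𝕜 := ℝ) (fun x hx => ?_)
    (fun x _ => han A _ c x) hUc.isPreconnected hc hAu
  obtain ⟨A', -, hA'⟩ := hloc x hx
  exact (han A' _ x x).congr hA'.symm

/-- Definiteness of `a₀` on `V_h`, for a subdomain which is clamped along a set of positive surface
measure. -/
lemma eq_zero_of_a0_self (hd : 2 ≤ d) (hΩ : Bornology.IsBounded Ω) (hUo : IsOpen U)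
    (hUc : IsConnected U) (hclamp : 0 < surf d (frontier Ω ∩ frontier U)) (hmu : 0 < mu)
    (hlam : 0 < 2 * mu + d * lam) (hu : u ∈ F.Vtilde.map (restrictTo hU))
    (h0 : a0 lam mu u u = 0) : u = 0 := by
  obtain ⟨A, b, c, hA, hAu⟩ := exists_rigid_of_a0_self hΩ hUo hUc hmu hlam hu h0
  obtain ⟨v, hv, rfl⟩ := hu
  -- The clamped points lie on the frontier of `U`, so the identity is first carried to the closure
  -- by continuity.
  have htr : EqOn (trace (restrictTo hU v)) (fun x => b + A (x - c)) (closure U) :=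
    ((trace_eqOn_zeroExt hU v).symm.trans hAu).of_subset_closure
      (continuousOn_trace_restrictTo hU v) (by fun_prop) subset_closure subset_rfl
  have hzero := eq_zero_of_surf_pos hd hA (b := b) (c := c) hclamp fun x hx => by
    have hxU : x ∈ closure U := frontier_subset_closure hx.2
    have h1 := htr hxU
    rw [trace_restrictTo hU v hxU, hv.1 _ hx.1] at h1
    exact h1.symm
  ext1 x
  have := hAu x.2
  rw [zeroExt_apply _ x.2] at this
  exact this.trans (hzero x)

end Coercivity

/-! ### The multiplier form and the load -/

section LinearForms

variable {d : ℕ}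

lemma integrable_inner_of_memLp {α : Type*} {m : MeasurableSpace α} {μ : Measure α}
    {f g : α → Vec d} (hf : MemLp f 2 μ) (hg : MemLp g 2 μ) :
    Integrable (fun x => inner ℝ (f x) (g x)) μ :=
  (hf.norm.integrable_mul hg.norm).mono' (hf.1.inner hg.1)
    (ae_of_all _ fun _ => norm_inner_le_norm _ _)

/-- `extendFrom` is additive only where the limits exist, which membership in `V_h` ensures on
`closure U`. -/
lemma trace_add {Ω U : Set (Vec d)} {F : FiniteElements Ω} {hU : U ⊆ Ω} {u v : U → Vec d}
    (hu : u ∈ F.Vtilde.map (restrictTo hU)) (hv : v ∈ F.Vtilde.map (restrictTo hU)) {x : Vec d}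
    (hx : x ∈ closure U) : trace (u + v) x = trace u x + trace v x := by
  obtain ⟨u, -, rfl⟩ := hu
  obtain ⟨v, -, rfl⟩ := hv
  rw [← map_add, trace_restrictTo hU _ hx, trace_restrictTo hU _ hx, trace_restrictTo hU _ hx]
  rfl

lemma trace_smul {Ω U : Set (Vec d)} {F : FiniteElements Ω} {hU : U ⊆ Ω} {u : U → Vec d}
    (hu : u ∈ F.Vtilde.map (restrictTo hU)) (c : ℝ) {x : Vec d}
    (hx : x ∈ closure U) : trace (c • u) x = c • trace u x := by
  obtain ⟨u, -, rfl⟩ := hu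
  rw [← map_smul, trace_restrictTo hU _ hx, trace_restrictTo hU _ hx]
  rfl

variable {G : CrackedDomain d} {F : FiniteElements G.Ω} {U : Set (Vec d)} {hU : U ⊆ G.Ω}
  {u : U → Vec d}

lemma CrackedDomain.measurableSet_Γ0 (G : CrackedDomain d) : MeasurableSet G.Γ0 :=
  (G.isOpen_Ω.measurableSet.diff
    (G.isOpen_Ωp.measurableSet.union G.isOpen_Ωm.measurableSet)).diff G.measurableSet_ΓT

lemma memLp_trace_Γ0 (hΓ : G.Γ ⊆ closure U) (hu : u ∈ F.Vtilde.map (restrictTo hU)) :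
    MemLp (trace u) 2 G.surfΓ0 := by
  obtain ⟨u, -, rfl⟩ := hu
  exact memLp_trace_restrictTo G.isBounded_Ω hU u G.measurableSet_Γ0 (sdiff_subset.trans hΓ)
    ((measure_mono sdiff_subset).trans_lt G.interface_finite) 2

lemma memLp_trace_ΓT (hΓ : G.Γ ⊆ closure U) (hu : u ∈ F.Vtilde.map (restrictTo hU)) :
    MemLp (trace u) 2 ((surf d).restrict G.ΓT) := by
  obtain ⟨u, -, rfl⟩ := hu
  exact memLp_trace_restrictTo G.isBounded_Ω hU u G.measurableSet_ΓT (G.ΓT_subset.trans hΓ)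
    ((measure_mono G.ΓT_subset).trans_lt G.interface_finite) 2

lemma memLp_outwardNormal_ΓT (hUo : IsOpen U)
    (hn : ∀ᵐ x ∂((surf d).restrict G.ΓT), ∃ n, IsOutwardUnitNormal U x n) :
    MemLp (outwardNormal U) 2 ((surf d).restrict G.ΓT) := by
  have : IsFiniteMeasure ((surf d).restrict G.ΓT) :=
    isFiniteMeasure_restrict.2 ((measure_mono G.ΓT_subset).trans_lt G.interface_finite).ne
  exact MemLp.of_bound (aemeasurable_outwardNormal hUo.measurableSet hn).aestronglyMeasurable 1
    (ae_of_all _ fun x => norm_outwardNormal_le U x)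

/-- `b₀` as a bilinear form on `W_h × V_h`. -/
noncomputable def b0Form (F : FiniteElements G.Ω) (M : MultiplierSpace G) (hU : U ⊆ G.Ω)
    (hΓ : G.Γ ⊆ closure U) : M.Wh →ₗ[ℝ] F.Vtilde.map (restrictTo hU) →ₗ[ℝ] ℝ :=
  LinearMap.mk₂ ℝ (fun m v => b0 G m.1 v.1)
    (fun m m' v => by
      unfold b0
      rw [← integral_add (integrable_inner_of_memLp (Lp.memLp m.1) (memLp_trace_Γ0 hΓ v.2))
        (integrable_inner_of_memLp (Lp.memLp m'.1) (memLp_trace_Γ0 hΓ v.2))]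
      refine integral_congr_ae ?_
      filter_upwards [Lp.coeFn_add m.1 m'.1] with x hx
      rw [Submodule.coe_add, hx, Pi.add_apply, inner_add_left])
    (fun c m v => by
      unfold b0
      rw [smul_eq_mul, ← integral_const_mul]
      refine integral_congr_ae ?_
      filter_upwards [Lp.coeFn_smul c m.1] with x hx
      rw [Submodule.coe_smul, hx, Pi.smul_apply, real_inner_smul_left])
    (fun m v v' => by
      unfold b0
      rw [← integral_add (integrable_inner_of_memLp (Lp.memLp m.1) (memLp_trace_Γ0 hΓ v.2))
        (integrable_inner_of_memLp (Lp.memLp m.1) (memLp_trace_Γ0 hΓ v'.2))]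
      refine integral_congr_ae ?_
      filter_upwards [ae_restrict_mem G.measurableSet_Γ0] with x hx
      rw [Submodule.coe_add, trace_add v.2 v'.2 (hΓ hx.1), inner_add_right])
    (fun c m v => by
      unfold b0
      rw [smul_eq_mul, ← integral_const_mul]
      refine integral_congr_ae ?_
      filter_upwards [ae_restrict_mem G.measurableSet_Γ0] with x hx
      rw [Submodule.coe_smul, trace_smul v.2 c (hΓ hx.1), real_inner_smul_right])

lemma integrable_load_volume {f : Vec d → Vec d} (hUo : IsOpen U)
    (hf : MemLp f 2 (volume.restrict G.Ω)) (hu : u ∈ F.Vtilde.map (restrictTo hU)) :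
    IntegrableOn (fun x => inner ℝ (f x) (zeroExt u x)) U := by
  obtain ⟨u, -, rfl⟩ := hu
  exact integrable_inner_of_memLp (hf.mono_measure (Measure.restrict_mono hU le_rfl))
    (memLp_zeroExt_restrictTo G.isBounded_Ω hUo hU u 2)

lemma integrable_load_ΓT (hUo : IsOpen U) (hΓ : G.Γ ⊆ closure U)
    (hn : ∀ᵐ x ∂((surf d).restrict G.ΓT), ∃ n, IsOutwardUnitNormal U x n) (p : ℝ)
    (hu : u ∈ F.Vtilde.map (restrictTo hU)) :
    IntegrableOn (fun x => inner ℝ (trace u x) (p • outwardNormal U x)) G.ΓT (surf d) :=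
  integrable_inner_of_memLp (memLp_trace_ΓT hΓ hu)
    ((memLp_outwardNormal_ΓT hUo hn).const_smul p)

/-- `l` as a linear form on `V_h`. -/
noncomputable def loadForm (F : FiniteElements G.Ω) {f : Vec d → Vec d}
    (hf : MemLp f 2 (volume.restrict G.Ω)) (hUo : IsOpen U) (hU : U ⊆ G.Ω) (hΓ : G.Γ ⊆ closure U)
    (hn : ∀ᵐ x ∂((surf d).restrict G.ΓT), ∃ n, IsOutwardUnitNormal U x n) (p : ℝ) :
    F.Vtilde.map (restrictTo hU) →ₗ[ℝ] ℝ where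
  toFun v := load G f p v.1
  map_add' v w := by
    have h1 : ∫ x in U, inner ℝ (f x) (zeroExt (v + w).1 x) =
        (∫ x in U, inner ℝ (f x) (zeroExt v.1 x)) + ∫ x in U, inner ℝ (f x) (zeroExt w.1 x) := by
      rw [← integral_add (integrable_load_volume hUo hf v.2) (integrable_load_volume hUo hf w.2)]
      simp only [Submodule.coe_add, zeroExt_add, Pi.add_apply, inner_add_right]
    have h2 : ∫ x in G.ΓT, inner ℝ (trace (v + w).1 x) (p • outwardNormal U x) ∂(surf d) =
        (∫ x in G.ΓT, inner ℝ (trace v.1 x) (p • outwardNormal U x) ∂(surf d)) +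
          ∫ x in G.ΓT, inner ℝ (trace w.1 x) (p • outwardNormal U x) ∂(surf d) := by
      rw [← integral_add (integrable_load_ΓT hUo hΓ hn p v.2) (integrable_load_ΓT hUo hΓ hn p w.2)]
      refine integral_congr_ae ?_
      filter_upwards [ae_restrict_mem G.measurableSet_ΓT] with x hx
      rw [Submodule.coe_add, trace_add v.2 w.2 (hΓ (G.ΓT_subset hx)), inner_add_left]
    unfold load
    rw [h1, h2]
    ring
  map_smul' c v := by
    have h1 : ∫ x in U, inner ℝ (f x) (zeroExt (c • v).1 x) =
        c * ∫ x in U, inner ℝ (f x) (zeroExt v.1 x) := by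
      rw [← integral_const_mul]
      simp only [Submodule.coe_smul, zeroExt_smul, Pi.smul_apply, real_inner_smul_right]
    have h2 : ∫ x in G.ΓT, inner ℝ (trace (c • v).1 x) (p • outwardNormal U x) ∂(surf d) =
        c * ∫ x in G.ΓT, inner ℝ (trace v.1 x) (p • outwardNormal U x) ∂(surf d) := by
      rw [← integral_const_mul]
      refine integral_congr_ae ?_
      filter_upwards [ae_restrict_mem G.measurableSet_ΓT] with x hx
      rw [Submodule.coe_smul, trace_smul v.2 c (hΓ (G.ΓT_subset hx)), real_inner_smul_left]
    unfold load
    rw [h1, h2, RingHom.id_apply, smul_eq_mul]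
    ring

end LinearForms

end CrackFEM

theorem mainTheorem3 {d : ℕ} (hd : d = 2 ∨ d = 3) (G : CrackFEM.CrackedDomain d)
    (F : CrackFEM.FiniteElements G.Ω) (M : CrackFEM.MultiplierSpace G)
    (lam mu : ℝ) (hmu : 0 < mu) (hlam : 0 < 2 * mu + d * lam)
    (f : CrackFEM.Vec d → CrackFEM.Vec d) (hf : MeasureTheory.MemLp f 2 (MeasureTheory.volume.restrict G.Ω))
    (p : ℝ) (hH : CrackFEM.HypothesisH G F M) :
    ∃! s : CrackFEM.Vp G F × CrackFEM.Vm G F × M.Wh,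
      CrackFEM.IsDiscreteSolution G F M lam mu f p s.1 s.2.1 s.2.2 := by
  have hd2 : 2 ≤ d := by omega
  -- The interface lies in both closures, so traces on `Γ` are genuine limits from either side.
  have hΓp : G.Γ ⊆ closure G.Ωp := fun x hx => frontier_subset_closure (G.interface_subset hx).1
  have hΓm : G.Γ ⊆ closure G.Ωm := fun x hx => frontier_subset_closure (G.interface_subset hx).2
  have key := CrackFEM.existsUnique_saddle_point
    (V₁ := F.Vtilde.map (CrackFEM.restrictTo G.Ωp_subset))
    (V₂ := F.Vtilde.map (CrackFEM.restrictTo G.Ωm_subset))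
    (CrackFEM.a0Form F G.isBounded_Ω G.isOpen_Ωp G.Ωp_subset lam mu)
    (CrackFEM.a0Form F G.isBounded_Ω G.isOpen_Ωm G.Ωm_subset lam mu)
    (CrackFEM.b0Form F M G.Ωp_subset hΓp) (CrackFEM.b0Form F M G.Ωm_subset hΓm)
    (CrackFEM.loadForm F hf G.isOpen_Ωp G.Ωp_subset hΓp
      (G.exists_normal.mono fun _ h => h.1) p)
    (CrackFEM.loadForm F hf G.isOpen_Ωm G.Ωm_subset hΓm
      (G.exists_normal.mono fun _ h => h.2) p)
    (fun u => CrackFEM.a0_self_nonneg hmu hlam u.1)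
    (fun u h => Subtype.ext (CrackFEM.eq_zero_of_a0_self hd2 G.isBounded_Ω G.isOpen_Ωp
      G.isConnected_Ωp G.clamped_p hmu hlam u.2 h))
    (fun u => CrackFEM.a0_self_nonneg hmu hlam u.1)
    (fun u h => Subtype.ext (CrackFEM.eq_zero_of_a0_self hd2 G.isBounded_Ω G.isOpen_Ωm
      G.isConnected_Ωm G.clamped_m hmu hlam u.2 h))
    (fun m h1 h2 => Subtype.ext (hH m.1 m.2 (fun v hv => h1 ⟨v, hv⟩) (fun v hv => h2 ⟨v, hv⟩)))
  refine (existsUnique_congr fun s => ?_).1 key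
  refine and_congr ?_ (and_congr ?_ ?_)
  · exact ⟨fun h v hv => h ⟨v, hv⟩, fun h v => h v.1 v.2⟩
  · exact ⟨fun h v hv => h ⟨v, hv⟩, fun h v => h v.1 v.2⟩
  · exact ⟨fun h m hm => h ⟨m, hm⟩, fun h m => h m.1 m.2⟩
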